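/- Let $\mathcal N$ be a von Neumann algebra on a Hilbert space with a semifinite faithful normal trace $\tau$. A projection $P\in\mathcal N$ is $\tau$-finite if $\tau(P)<\infty$; let $\mathcal K$ be the norm closure of the two-sided ideal of $\mathcal N$ generated by the $\tau$-finite projections, and $\pi:\mathcal N\to\mathcal N/\mathcal K$ the quotient map. For projections $P,Q\in\mathcal N$, an operator $T\in\mathcal N$ is $(P\cdot Q)$-Fredholm if the projections $\mathrm{Ker}(T)\cap Q$ and $\mathrm{Ker}(T^*)\cap P$ are $\tau$-finite and there is a projection $E\in\mathcal N$ with $P-E$ a $\tau$-finite projection and $\mathrm{Ran}(E)\subset\mathrm{Ran}(T)$; Breuer–Fredholm means $(1\cdot1)$-Fredholm. The index of such $T$ is $\mathrm{Ind}_{(P\cdot Q)}(T)=\tau(\mathrm{Ker}(T)\cap Q)-\tau(\mathrm{Ker}(T^*)\cap P)$, and $\mathrm{ec}(P,Q)=\mathrm{Ind}_{(P\cdot Q)}(PQ)$. For a norm-continuous path $\{F_t\}_{t\in[0,1]}$ of self-adjoint Breuer–Fredholm operators in $\mathcal N$ and a partition $0=t_0<\dots<t_{n+1}=1$ such that $\|\pi(\chi(F_s\ge0)-\chi(F_r\ge0))\|\le\frac12$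 whenever $r,s$ lie in the same interval $[t_k,t_{k+1}]$, the spectral flow is $\mathrm{SF}(\{F_t\})=\sum_{k=0}^{n}\mathrm{ec}(p_k,p_{k+1})$ with $p_k=\chi(F_{t_k}\ge0)$. For self-adjoint $T\in\mathcal N$ with $\tau$-finite support projection, $\mathrm{Sig}(T)=\tau(\chi(T>0)-\chi(T<0))$. The projection onto the kernel of $T$ is also written $\mathrm{Ker}(T)$. **Proposition.** Let $P\in\mathcal N$ be a $\tau$-finite projection and $\{T_t\}_{t\in[0,1]}$ a norm-continuous path of self-adjoint elements of $\mathcal N$ whose support projections and range projections all satisfy $\mathrm{Supp}(T_t)\le P$ and $\mathrm{Ran}(T_t)\le P$. Then $F_t=PT_tP+1-P$ is a norm-continuous path of self-adjoint Breuer–Fredholm operators in $\mathcal N$, the projections $\mathrm{Supp}(T_t)$ and $P\,\mathrm{Ker}(T_t)$ are $\tau$-finite, the spectral flow of $\{F_t\}$ is well defined (partitions as above exist, the essential codimensions are defined, and the sum does not depend on the partition), and $$\mathrm{SF}(\{F_t\})=\tfrac12\big(\mathrm{Sig}(T_1)-\mathrm{Sig}(T_0)\big)+\tfrac12\big(\tau(P\,\mathrm{Ker}(T_1))-\tau(P\,\mathrm{Ker}(T_0))\big).$$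 In particular, if $T_0$ and $T_1$ are invertible elements of the algebra $P\mathcal NP$, then the second term vanishes, so that $\mathrm{SF}(\{F_t\})=\tfrac12(\mathrm{Sig}(T_1)-\mathrm{Sig}(T_0))$. -/

import Mathlib

open scoped ENNReal NNReal ComplexOrder

noncomputable section

namespace SemifiniteFlow

universe u

/-- A semifinite faithful normal trace on the von Neumann algebra `N`, as a `[0, ∞]`-valued
function on the positive cone of `N`.  (The function is total for convenience; nothing is
said about its values off the positive cone of `N`.)  The order is the Loewner order. -/
structure NormalTrace {H : Type u} [NormedAddCommGroup H] [InnerProductSpace ℂ H]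
    [CompleteSpace H] (N : VonNeumannAlgebra H) where
  toFun : (H →L[ℂ] H) → ℝ≥0∞
  map_add : ∀ x ∈ N, ∀ y ∈ N, 0 ≤ x → 0 ≤ y → toFun (x + y) = toFun x + toFun y
  map_smul : ∀ (c : ℝ≥0), ∀ x ∈ N, 0 ≤ x → toFun (((c : ℝ) : ℂ) • x) = (c : ℝ≥0∞) * toFun x
  tracial : ∀ x ∈ N, toFun (star x * x) = toFun (x * star x)
  faithful : ∀ x ∈ N, 0 ≤ x → toFun x = 0 → x = 0
  normal : ∀ s : Set (H →L[ℂ] H), s.Nonempty → DirectedOn (· ≤ ·) s →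
    (∀ y ∈ s, y ∈ N ∧ 0 ≤ y) → ∀ x ∈ N, IsLUB s x → toFun x = ⨆ y ∈ s, toFun y
  semifinite : ∀ x ∈ N, 0 ≤ x → x ≠ 0 → ∃ y ∈ N, 0 ≤ y ∧ y ≤ x ∧ y ≠ 0 ∧ toFun y < ∞

variable {H : Type u} [NormedAddCommGroup H] [InnerProductSpace ℂ H] [CompleteSpace H]

/-- The orthogonal projection onto the kernel of `T`. -/
def kerProj (T : H →L[ℂ] H) : H →L[ℂ] H :=
  (LinearMap.ker (T : H →ₗ[ℂ] H)).topologicalClosure.starProjection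

/-- The range projection of `T`: the orthogonal projection onto the closure of the range. -/
def rangeProj (T : H →L[ℂ] H) : H →L[ℂ] H :=
  (LinearMap.range (T : H →ₗ[ℂ] H)).topologicalClosure.starProjection

/-- The support projection of `T`. -/
def suppProj (T : H →L[ℂ] H) : H →L[ℂ] H := 1 - kerProj T

/-- The projection `P ∩ Q` onto `Ran P ∩ Ran Q` (for projections `P`, `Q`). -/
def meetProj (P Q : H →L[ℂ] H) : H →L[ℂ] H :=
  (LinearMap.range (P : H →ₗ[ℂ] H) ⊓
    LinearMap.range (Q : H →ₗ[ℂ] H)).topologicalClosure.starProjection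

/-- The spectral projection `χ(T > 0)` of a self-adjoint `T`:
the support projection of the positive part `max(T, 0)`. -/
def specPos (T : H →L[ℂ] H) : H →L[ℂ] H := suppProj T⁺

/-- The spectral projection `χ(T < 0)` of a self-adjoint `T`:
the support projection of the negative part `max(-T, 0)`. -/
def specNeg (T : H →L[ℂ] H) : H →L[ℂ] H := suppProj T⁻

/-- The spectral projection `χ(T ≥ 0)` of a self-adjoint `T`. -/
def specNonneg (T : H →L[ℂ] H) : H →L[ℂ] H := 1 - specNeg T

/-- `sgn(T) = χ(T > 0) - χ(T < 0)`. -/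
def sgn (T : H →L[ℂ] H) : H →L[ℂ] H := specPos T - specNeg T

namespace NormalTrace

variable {N : VonNeumannAlgebra H}

instance : CoeFun (NormalTrace N) (fun _ => (H →L[ℂ] H) → ℝ≥0∞) := ⟨toFun⟩

/-- The extension of the trace to self-adjoint trace-class elements:
`τ(x) = τ(x₊) - τ(x₋)`. -/
def onSelfAdjoint (τ : NormalTrace N) (x : H →L[ℂ] H) : ℝ := (τ x⁺).toReal - (τ x⁻).toReal

/-- `P` is a `τ`-finite projection of `N`. -/
structure IsFiniteProj (τ : NormalTrace N) (P : H →L[ℂ] H) : Prop where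
  mem : P ∈ N
  isStarProjection : IsStarProjection P
  finite : τ P < ∞

/-- The ideal of `τ`-compact operators: the norm closure of the two-sided ideal of `N`
generated by the `τ`-finite projections. -/
def compactIdeal (τ : NormalTrace N) : Submodule ℂ (H →L[ℂ] H) :=
  (Submodule.span ℂ {x | ∃ a ∈ N, ∃ b ∈ N, ∃ p, τ.IsFiniteProj p ∧
    x = a * p * b}).topologicalClosure

/-- The norm `‖π(x)‖` of the class of `x ∈ N` in the Calkin algebra `N / K`, that is, the
quotient norm `inf {‖x - k‖ : k ∈ K}`. -/
def calkinNorm (τ : NormalTrace N) (x : H →L[ℂ] H) : ℝ :=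
  Metric.infDist x (τ.compactIdeal : Set (H →L[ℂ] H))

/-- `T ∈ N` is `(P · Q)`-Fredholm, for projections `P`, `Q` of `N`. -/
structure IsSkewFredholm (τ : NormalTrace N) (P Q T : H →L[ℂ] H) : Prop where
  mem : T ∈ N
  ker_finite : τ.IsFiniteProj (meetProj (kerProj T) Q)
  coker_finite : τ.IsFiniteProj (meetProj (kerProj (star T)) P)
  exists_proj : ∃ E, E ∈ N ∧ IsStarProjection E ∧ τ.IsFiniteProj (P - E) ∧
    LinearMap.range (E : H →ₗ[ℂ] H) ≤ LinearMap.range (T : H →ₗ[ℂ] H)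

/-- The semifinite index `Ind_(P · Q)(T)`. -/
def skewIndex (τ : NormalTrace N) (P Q T : H →L[ℂ] H) : ℝ :=
  (τ (meetProj (kerProj T) Q)).toReal - (τ (meetProj (kerProj (star T)) P)).toReal

/-- The essential codimension `ec(P, Q) = Ind_(P · Q)(PQ)`. -/
def essCodim (τ : NormalTrace N) (P Q : H →L[ℂ] H) : ℝ := τ.skewIndex P Q (P * Q)

/-- The set of self-adjoint Breuer-Fredholm operators in `N`. -/
def saFredholm (τ : NormalTrace N) : Set (H →L[ℂ] H) :=
  {T | IsSelfAdjoint T ∧ τ.IsSkewFredholm 1 1 T}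

/-- `0 = t₀ < t₁ < ⋯ < t_{n+1} = 1` is a partition which is sufficiently fine for the path `F`:
on each of its intervals the classes in the Calkin algebra of the projections `χ(F_s ≥ 0)`
vary by at most `1/2` in norm. -/
structure IsFinePartition (τ : NormalTrace N) (F : unitInterval → H →L[ℂ] H) (n : ℕ)
    (t : Fin (n + 2) → unitInterval) : Prop where
  strictMono : StrictMono t
  first : t 0 = 0
  last : t (Fin.last (n + 1)) = 1
  fine : ∀ k : Fin (n + 1), ∀ r ∈ Set.Icc (t k.castSucc) (t k.succ),
    ∀ s ∈ Set.Icc (t k.castSucc) (t k.succ),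
      τ.calkinNorm (specNonneg (F s) - specNonneg (F r)) ≤ 1 / 2

/-- The spectral flow of the path `F` of self-adjoint Breuer-Fredholm operators is well defined
and equal to `r`: sufficiently fine partitions exist, and for each of them all the essential
codimensions `ec(p_k, p_{k+1})`, `p_k = χ(F_{t_k} ≥ 0)`, are defined and their sum is `r`. -/
def HasSpectralFlow (τ : NormalTrace N) (F : unitInterval → H →L[ℂ] H) (r : ℝ) : Prop :=
  (∃ (n : ℕ) (t : Fin (n + 2) → unitInterval), τ.IsFinePartition F n t) ∧
  ∀ (n : ℕ) (t : Fin (n + 2) → unitInterval), τ.IsFinePartition F n t →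
    (∀ k : Fin (n + 1),
      τ.IsSkewFredholm (specNonneg (F (t k.castSucc))) (specNonneg (F (t k.succ)))
        (specNonneg (F (t k.castSucc)) * specNonneg (F (t k.succ)))) ∧
    ∑ k : Fin (n + 1),
      τ.essCodim (specNonneg (F (t k.castSucc))) (specNonneg (F (t k.succ))) = r

/-- The signature `Sig(T) = τ(sgn(T))` of a self-adjoint `T` with `τ`-finite support. -/
def sig (τ : NormalTrace N) (T : H →L[ℂ] H) : ℝ := τ.onSelfAdjoint (sgn T)

end NormalTrace

/-- `T` is an invertible element of the algebra `P N P`, whose unit is `P`. -/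
def IsInvertibleInCorner (N : VonNeumannAlgebra H) (P T : H →L[ℂ] H) : Prop :=
  (T ∈ N ∧ P * T * P = T) ∧ ∃ S ∈ N, P * S * P = S ∧ T * S = P ∧ S * T = P

end SemifiniteFlow

end

open scoped ENNReal NNReal ComplexOrder

namespace SemifiniteFlow

variable {H : Type*} [NormedAddCommGroup H] [InnerProductSpace ℂ H]

/-! Since `T_t` lives in the corner of `P`, `F_t = T_t + (1 - P)` is a sum of orthogonal pieces, and
the second is positive. So `F_t` and `T_t` have the same negative part, and `χ(F_t ≥ 0) = 1 - n_t`
with `n_t = χ(T_t < 0) ≤ P` of finite trace. All these projections agree modulo the compact ideal,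
hence every partition is fine. Kaplansky's formula `ec(1 - n, 1 - m) = τ(n) - τ(m)` makes the sum
telescope to `τ(n_0) - τ(n_1)`. Finally `P` is the orthogonal sum of `χ(T > 0)`, `χ(T < 0)` and `P
Ker(T)`, so `Sig(T) + τ(P Ker(T)) = τ(P) - 2 τ(χ(T < 0))`; subtracting the end points cancels
`τ(P)`.

The analytic core is `τ(supp x) = τ(supp x*)` for a contraction `x` (`map_suppProj_star`), proved
without polar decomposition. For `0 ≤ a ≤ 1` the elements `1 - (1 - a)^k` increase to the support of
`a`; normality passes the trace to the limit, and traciality matches the terms for `x* x` and `x x*`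
at each `k`. Applied to `x = m n`, this equates the parts of `n` and `m` that do not contribute to
the index. -/

theorem apply_apply_of_isIdempotentElem {p : H →L[ℂ] H} (hp : IsIdempotentElem p) (x : H) :
    p (p x) = p x :=
  DFunLike.congr_fun hp.eq x

theorem mem_range_iff_apply_eq_self {p : H →L[ℂ] H} (hp : IsIdempotentElem p) {x : H} :
    x ∈ LinearMap.range (p : H →ₗ[ℂ] H) ↔ p x = x := by
  refine ⟨?_, fun h => ⟨x, h⟩⟩
  rintro ⟨y, rfl⟩
  exact apply_apply_of_isIdempotentElem hp y

variable [CompleteSpace H]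

/-! ### Kernel, support and meet projections -/

theorem isStarProjection_kerProj (T : H →L[ℂ] H) : IsStarProjection (kerProj T) :=
  isStarProjection_starProjection

theorem isStarProjection_suppProj (T : H →L[ℂ] H) : IsStarProjection (suppProj T) :=
  (isStarProjection_kerProj T).one_sub

theorem isStarProjection_meetProj (P Q : H →L[ℂ] H) : IsStarProjection (meetProj P Q) :=
  isStarProjection_starProjection

theorem kerProj_apply_eq_self_iff {T : H →L[ℂ] H} {x : H} : kerProj T x = x ↔ T x = 0 := by
  have hc : IsClosed ((LinearMap.ker (T : H →ₗ[ℂ] H) : Submodule ℂ H) : Set H) := T.isClosed_ker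
  rw [kerProj, Submodule.starProjection_eq_self_iff, hc.submodule_topologicalClosure_eq]
  simp

theorem meetProj_apply_eq_self_iff {P Q : H →L[ℂ] H} (hP : IsStarProjection P)
    (hQ : IsStarProjection Q) {x : H} : meetProj P Q x = x ↔ P x = x ∧ Q x = x := by
  have hP' : IsClosed ((LinearMap.range (P : H →ₗ[ℂ] H) : Submodule ℂ H) : Set H) := by
    convert isClosed_eq P.continuous continuous_id using 1
    ext y; exact mem_range_iff_apply_eq_self hP.isIdempotentElem
  have hQ' : IsClosed ((LinearMap.range (Q : H →ₗ[ℂ] H) : Submodule ℂ H) : Set H) := by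
    convert isClosed_eq Q.continuous continuous_id using 1
    ext y; exact mem_range_iff_apply_eq_self hQ.isIdempotentElem
  have hc : IsClosed ((LinearMap.range (P : H →ₗ[ℂ] H) ⊓
      LinearMap.range (Q : H →ₗ[ℂ] H) : Submodule ℂ H) : Set H) := hP'.inter hQ'
  rw [meetProj, Submodule.starProjection_eq_self_iff, hc.submodule_topologicalClosure_eq,
    Submodule.mem_inf, mem_range_iff_apply_eq_self hP.isIdempotentElem,
    mem_range_iff_apply_eq_self hQ.isIdempotentElem]

/-- Star projections with the same fixed vectors are equal. -/
theorem eq_of_apply_eq_self_iff {p q : H →L[ℂ] H} (hp : IsStarProjection p)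
    (hq : IsStarProjection q) (h : ∀ x, p x = x ↔ q x = x) : p = q := by
  refine (ContinuousLinearMap.IsStarProjection.ext_iff hp hq).2 ?_
  ext x
  exact (mem_range_iff_apply_eq_self hp.isIdempotentElem).trans
    ((h x).trans (mem_range_iff_apply_eq_self hq.isIdempotentElem).symm)

/-- A star projection whose fixed vectors are fixed by the star projection `q` is below `q`. -/
theorem le_of_apply_eq_self {p q : H →L[ℂ] H} (hp : IsStarProjection p)
    (hq : IsStarProjection q) (h : ∀ x, p x = x → q x = x) : p ≤ q := by
  refine (hp.le_iff_mul_eq_right hq).2 (ContinuousLinearMap.ext fun x => ?_)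
  exact h (p x) (apply_apply_of_isIdempotentElem hp.isIdempotentElem x)

theorem mul_kerProj (T : H →L[ℂ] H) : T * kerProj T = 0 := by
  ext x
  exact (kerProj_apply_eq_self_iff (T := T)).1
    (apply_apply_of_isIdempotentElem (isStarProjection_kerProj T).isIdempotentElem x)

theorem mul_suppProj (T : H →L[ℂ] H) : T * suppProj T = T := by
  rw [suppProj, mul_sub, mul_kerProj, mul_one, sub_zero]

theorem kerProj_star_mul_self (T : H →L[ℂ] H) : kerProj (star T * T) = kerProj T := by
  refine eq_of_apply_eq_self_iff (isStarProjection_kerProj _) (isStarProjection_kerProj _) ?_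
  intro x
  rw [kerProj_apply_eq_self_iff, kerProj_apply_eq_self_iff]
  refine ⟨fun h => ?_, fun h => by simp [h]⟩
  rw [← inner_self_eq_zero (𝕜 := ℂ), ← ContinuousLinearMap.adjoint_inner_left]
  change inner ℂ ((star T * T) x) x = 0
  rw [h, inner_zero_left]

theorem suppProj_star_mul_self (T : H →L[ℂ] H) : suppProj (star T * T) = suppProj T := by
  rw [suppProj, suppProj, kerProj_star_mul_self]

theorem kerProj_mul_eq_self {T q : H →L[ℂ] H} (h : T * q = 0) : kerProj T * q = q := by
  ext x
  exact (kerProj_apply_eq_self_iff (T := T)).2 (DFunLike.congr_fun h x)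

theorem suppProj_mul_eq_zero {T q : H →L[ℂ] H} (h : T * q = 0) : suppProj T * q = 0 := by
  rw [suppProj, sub_mul, one_mul, kerProj_mul_eq_self h, sub_self]

theorem suppProj_le {T p : H →L[ℂ] H} (hp : IsStarProjection p) (h : T * (1 - p) = 0) :
    suppProj T ≤ p := by
  rw [(isStarProjection_suppProj T).le_iff_mul_eq_left hp]
  have := suppProj_mul_eq_zero h
  rw [mul_sub, mul_one, sub_eq_zero] at this
  exact this.symm

/-- The range projections of self-adjoint operators with vanishing product are orthogonal. -/
theorem suppProj_mul_suppProj_eq_zero {a b : H →L[ℂ] H} (hb : IsSelfAdjoint b)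
    (h : a * b = 0) : suppProj a * suppProj b = 0 := by
  have h1 : b * suppProj a = 0 := by
    have := congrArg star (suppProj_mul_eq_zero h)
    rwa [star_mul, hb.star_eq, (isStarProjection_suppProj a).isSelfAdjoint.star_eq,
      star_zero] at this
  have := congrArg star (suppProj_mul_eq_zero h1)
  rwa [star_mul, (isStarProjection_suppProj a).isSelfAdjoint.star_eq,
    (isStarProjection_suppProj b).isSelfAdjoint.star_eq, star_zero] at this

/-! ### Membership in a von Neumann algebra -/

variable {N : VonNeumannAlgebra H}

/-- `N` is its own double commutant. This puts functional calculus in `N`, since it commutes with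
whatever `T` and `T*` commute with. -/
theorem mem_of_forall_commute {x : H →L[ℂ] H} (h : ∀ y ∈ N.commutant, Commute x y) : x ∈ N := by
  rw [← N.commutant_commutant, VonNeumannAlgebra.mem_commutant_iff]
  exact fun y hy => (h y hy).symm.eq

theorem commute_of_mem_commutant {x y : H →L[ℂ] H} (hx : x ∈ N) (hy : y ∈ N.commutant) :
    Commute x y :=
  VonNeumannAlgebra.mem_commutant_iff.1 hy x hx

theorem negPart_mem {T : H →L[ℂ] H} (hT : T ∈ N) : T⁻ ∈ N :=
  mem_of_forall_commute fun _ hy => (commute_of_mem_commutant hT hy).cfcₙ_real _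

theorem posPart_mem {T : H →L[ℂ] H} (hT : T ∈ N) : T⁺ ∈ N :=
  mem_of_forall_commute fun _ hy => (commute_of_mem_commutant hT hy).cfcₙ_real _

theorem sqrt_mem {T : H →L[ℂ] H} (hT : T ∈ N) : CFC.sqrt T ∈ N :=
  mem_of_forall_commute fun _ hy => (commute_of_mem_commutant hT hy).cfcₙ_nnreal _

theorem kerProj_mem {T : H →L[ℂ] H} (hT : T ∈ N) : kerProj T ∈ N := by
  rw [VonNeumannAlgebra.IsStarProjection.mem_iff (isStarProjection_kerProj T)]
  intro y hy x hx
  have hx' := (mem_range_iff_apply_eq_self (isStarProjection_kerProj T).isIdempotentElem).1 hx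
  refine (mem_range_iff_apply_eq_self (isStarProjection_kerProj T).isIdempotentElem).2 ?_
  rw [kerProj_apply_eq_self_iff] at hx' ⊢
  have := DFunLike.congr_fun (commute_of_mem_commutant hT hy).eq x
  simpa [hx'] using this

theorem suppProj_mem {T : H →L[ℂ] H} (hT : T ∈ N) : suppProj T ∈ N :=
  sub_mem (one_mem N) (kerProj_mem hT)

theorem meetProj_mem {P Q : H →L[ℂ] H} (hP : P ∈ N) (hQ : Q ∈ N) (hP' : IsStarProjection P)
    (hQ' : IsStarProjection Q) : meetProj P Q ∈ N := by
  rw [VonNeumannAlgebra.IsStarProjection.mem_iff (isStarProjection_meetProj P Q)]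
  intro y hy x hx
  have hx' := (mem_range_iff_apply_eq_self (isStarProjection_meetProj P Q).isIdempotentElem).1 hx
  refine (mem_range_iff_apply_eq_self (isStarProjection_meetProj P Q).isIdempotentElem).2 ?_
  rw [meetProj_apply_eq_self_iff hP' hQ'] at hx' ⊢
  have h1 := DFunLike.congr_fun (commute_of_mem_commutant hP hy).eq x
  have h2 := DFunLike.congr_fun (commute_of_mem_commutant hQ hy).eq x
  exact ⟨by simpa [hx'.1] using h1, by simpa [hx'.2] using h2⟩

/-! ### Support projections as least upper bounds -/

theorem one_sub_pow_nonneg {a : H →L[ℂ] H} (ha1 : a ≤ 1) (k : ℕ) : 0 ≤ (1 - a) ^ k := by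
  induction k with
  | zero => simp
  | succ k ih =>
    rw [pow_succ]
    exact Commute.mul_nonneg ih (sub_nonneg.2 ha1) ((Commute.refl _).pow_left k)

/-- Each increment is `(1 - a)^k a`, a product of commuting positive operators. -/
theorem one_sub_one_sub_pow_mono {a : H →L[ℂ] H} (ha : 0 ≤ a) (ha1 : a ≤ 1) :
    Monotone fun k : ℕ => 1 - (1 - a) ^ k := by
  refine monotone_nat_of_le_succ fun k => ?_
  rw [← sub_nonneg]
  have : (1 - (1 - a) ^ (k + 1)) - (1 - (1 - a) ^ k) = (1 - a) ^ k * a := by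
    rw [pow_succ]; noncomm_ring
  rw [this]
  exact Commute.mul_nonneg (one_sub_pow_nonneg ha1 k) ha
    (((Commute.one_left a).sub_left (Commute.refl a)).pow_left k)

/-- Von Neumann's mean ergodic theorem for the contraction `1 - a`, whose fixed vectors are the
kernel of `a`. -/
theorem tendsto_birkhoffAverage_kerProj {a : H →L[ℂ] H} (ha : 0 ≤ a) (ha1 : a ≤ 1) (x : H) :
    Filter.Tendsto (fun n => birkhoffAverage ℂ (⇑(1 - a)) id n x) Filter.atTop
      (nhds (kerProj a x)) := by
  have hb : ‖1 - a‖ ≤ 1 :=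
    (CStarAlgebra.norm_le_one_iff_of_nonneg _ (sub_nonneg.2 ha1)).2 (by simpa using ha)
  convert (1 - a).tendsto_birkhoffAverage_orthogonalProjection hb x using 2
  rw [← Submodule.starProjection_apply]
  congr 1
  refine eq_of_apply_eq_self_iff (isStarProjection_kerProj _) isStarProjection_starProjection ?_
  intro y
  rw [kerProj_apply_eq_self_iff, Submodule.starProjection_eq_self_iff]
  simp [LinearMap.mem_eqLocus]

/-- With `s` the support, `s - (1 - (1 - a)^k)` is the compression of `(1 - a)^k ≥ 0` by `s`, which
gives the upper bound. An upper bound `y` satisfies `1 - y ≤ (1 - a)^k` for all `k`, hence lies on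
the right side of every Cesàro mean, and these tend to the kernel projection. Means suffice, so
strong convergence of the powers is not required. -/
theorem isLUB_range_one_sub_one_sub_pow {a : H →L[ℂ] H} (ha : 0 ≤ a) (ha1 : a ≤ 1) :
    IsLUB (Set.range fun k : ℕ => 1 - (1 - a) ^ k) (suppProj a) := by
  constructor
  · rintro _ ⟨k, rfl⟩
    have hK := isStarProjection_kerProj a
    have hr : ∀ k : ℕ, (1 - a) ^ k * kerProj a = kerProj a := by
      intro k
      induction k with
      | zero => simp
      | succ k ih => rw [pow_succ, mul_assoc, sub_mul, mul_kerProj, one_mul, sub_zero, ih]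
    have hl : kerProj a * (1 - a) ^ k = kerProj a := by
      have := congrArg star (hr k)
      rwa [star_mul, hK.isSelfAdjoint.star_eq,
        (one_sub_pow_nonneg ha1 k).isSelfAdjoint.star_eq] at this
    have : suppProj a - (1 - (1 - a) ^ k) =
        suppProj a * (1 - a) ^ k * suppProj a := by
      have h2 : kerProj a * kerProj a = kerProj a := hK.isIdempotentElem.eq
      simp only [suppProj, sub_mul, mul_sub, one_mul, mul_one, hl, hr k, h2]
      abel
    change 1 - (1 - a) ^ k ≤ suppProj a
    rw [← sub_nonneg, this]
    exact (isStarProjection_suppProj a).isSelfAdjoint.conjugate_nonneg (one_sub_pow_nonneg ha1 k)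
  · intro y hy
    have hy' : ∀ k : ℕ, 1 - (1 - a) ^ k ≤ y := fun k => hy ⟨k, rfl⟩
    -- The term `k = 0` is `0`, so `y` is positive and in particular self-adjoint, as the quadratic
    -- form description of the order demands.
    have hy0 : 0 ≤ y := by simpa using hy' 0
    rw [suppProj, sub_le_comm, ContinuousLinearMap.le_def]
    refine ⟨?_, fun x => ?_⟩
    · exact ContinuousLinearMap.isSelfAdjoint_iff_isSymmetric.1
        ((isStarProjection_kerProj a).isSelfAdjoint.sub
          ((IsSelfAdjoint.one _).sub hy0.isSelfAdjoint))
    · rw [ContinuousLinearMap.reApplyInnerSelf_apply, sub_apply,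
        inner_sub_left, map_sub, sub_nonneg]
      have hlim : Filter.Tendsto
          (fun n => RCLike.re (inner ℂ (birkhoffAverage ℂ (⇑(1 - a)) id n x) x))
          Filter.atTop (nhds (RCLike.re (inner ℂ (kerProj a x) x))) :=
        (RCLike.continuous_re.tendsto _).comp
          ((tendsto_birkhoffAverage_kerProj ha ha1 x).inner tendsto_const_nhds)
      refine ge_of_tendsto hlim ?_
      filter_upwards [Filter.eventually_gt_atTop 0] with n hn
      have hterm : ∀ k : ℕ, RCLike.re (inner ℂ ((1 - y) x) x) ≤
          RCLike.re (inner ℂ ((⇑(1 - a))^[k] x) x) := by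
        intro k
        have h1 : 1 - y ≤ (1 - a) ^ k := by
          rw [sub_le_comm]; exact hy' k
        have h2 := ((ContinuousLinearMap.le_def _ _).1 h1).2 x
        rw [ContinuousLinearMap.reApplyInnerSelf_apply, sub_apply,
          inner_sub_left, map_sub, sub_nonneg] at h2
        rwa [← FunLike.coe_pow_eq_iterate]
      have hsum : RCLike.re (inner ℂ (birkhoffAverage ℂ (⇑(1 - a)) id n x) x) =
          (n : ℝ)⁻¹ * ∑ k ∈ Finset.range n, RCLike.re (inner ℂ ((⇑(1 - a))^[k] x) x) := by
        rw [birkhoffAverage, birkhoffSum, inner_smul_left, sum_inner]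
        rw [show (starRingEnd ℂ) ((n : ℂ)⁻¹) = (((n : ℝ)⁻¹ : ℝ) : ℂ) by simp]
        simp [-FunLike.coe_sub]
      rw [hsum]
      have hn' : (0 : ℝ) < n := by exact_mod_cast hn
      rw [← div_eq_inv_mul, le_div_iff₀ hn']
      have := Finset.card_nsmul_le_sum (Finset.range n) _ _ fun k _ => hterm k
      rw [Finset.card_range, nsmul_eq_mul] at this
      linarith

/-! ### Kaplansky's formula -/

theorem one_sub_one_sub_pow_eq {R : Type*} [Ring R] (a : R) (k : ℕ) :
    1 - (1 - a) ^ k = (∑ j ∈ Finset.range k, (1 - a) ^ j) * a := by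
  simpa using (geom_sum_mul_neg (1 - a) k).symm

/-- `x` intertwines `1 - y x` with `1 - x y`, hence their powers. -/
theorem mul_one_sub_pow_mul {R : Type*} [Ring R] (x y : R) (k : ℕ) :
    x * (1 - y * x) ^ k * y = (1 - x * y) ^ k * (x * y) := by
  have h : SemiconjBy x (1 - y * x) (1 - x * y) := by
    rw [SemiconjBy]; noncomm_ring
  rw [(h.pow_right k).eq, mul_assoc]

namespace NormalTrace

variable (τ : NormalTrace N)

theorem map_mono {x y : H →L[ℂ] H} (hx : x ∈ N) (hy : y ∈ N) (hx0 : 0 ≤ x) (hxy : x ≤ y) :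
    τ x ≤ τ y := by
  have h := τ.map_add x hx (y - x) (sub_mem hy hx) hx0 (sub_nonneg.2 hxy)
  rw [add_sub_cancel] at h
  exact h ▸ le_self_add

theorem map_suppProj_eq_iSup {a : H →L[ℂ] H} (haN : a ∈ N) (ha : 0 ≤ a) (ha1 : a ≤ 1) :
    τ (suppProj a) = ⨆ k : ℕ, τ (1 - (1 - a) ^ k) := by
  have hmono := one_sub_one_sub_pow_mono ha ha1
  rw [τ.normal (Set.range fun k : ℕ => 1 - (1 - a) ^ k) (Set.range_nonempty _)
    hmono.directed_le.directedOn_range ?_ _ (suppProj_mem haN)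
    (isLUB_range_one_sub_one_sub_pow ha ha1), iSup_range]
  rintro _ ⟨k, rfl⟩
  exact ⟨sub_mem (one_mem N) (pow_mem (sub_mem (one_mem N) haN) k),
    by simpa using hmono (Nat.zero_le k)⟩

/-- If `b ≥ 0` commutes with `x* x`, then `τ(x b x*) = τ(b x* x)`. -/
theorem map_conj_eq {x b : H →L[ℂ] H} (hx : x ∈ N) (hb : b ∈ N) (hb0 : 0 ≤ b)
    (hc : Commute b (star x * x)) : τ (x * b * star x) = τ (b * (star x * x)) := by
  have hs : star (CFC.sqrt b) = CFC.sqrt b := (CFC.sqrt_nonneg b).isSelfAdjoint.star_eq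
  have hsc : Commute (CFC.sqrt b) (star x * x) := hc.cfcₙ_nnreal _
  -- Splitting `b` into square roots turns both sides into `z z*` and `z* z` with `z = x √b`.
  have h := τ.tracial (x * CFC.sqrt b) (mul_mem hx (sqrt_mem hb))
  have h1 : x * CFC.sqrt b * star (x * CFC.sqrt b) = x * b * star x := by
    rw [star_mul, hs, ← mul_assoc, mul_assoc x, CFC.sqrt_mul_sqrt_self b hb0]
  have h2 : star (x * CFC.sqrt b) * (x * CFC.sqrt b) = b * (star x * x) := by
    rw [star_mul, hs, mul_assoc, ← mul_assoc (star x), ← hsc.eq, ← mul_assoc,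
      CFC.sqrt_mul_sqrt_self b hb0]
  rw [← h1, ← h2, h]

/-- The supports of a contraction and of its adjoint have the same trace. -/
theorem map_suppProj_star {x : H →L[ℂ] H} (hx : x ∈ N) (hx1 : ‖x‖ ≤ 1) :
    τ (suppProj (star x)) = τ (suppProj x) := by
  have hle : ∀ y : H →L[ℂ] H, ‖y‖ ≤ 1 → star y * y ≤ 1 := fun y hy => by
    rw [← CStarAlgebra.norm_le_one_iff_of_nonneg _ (star_mul_self_nonneg y),
      CStarRing.norm_star_mul_self]
    exact mul_le_one₀ hy (norm_nonneg _) hy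
  have h1 := hle x hx1
  have h2 := hle (star x) (by rwa [norm_star])
  have hmem : ∀ k : ℕ, (1 - star x * x) ^ k ∈ N := fun k =>
    pow_mem (sub_mem (one_mem N) (mul_mem (star_mem hx) hx)) k
  rw [← suppProj_star_mul_self (star x), ← suppProj_star_mul_self x,
    τ.map_suppProj_eq_iSup (mul_mem (star_mem hx) hx) (star_mul_self_nonneg x) h1,
    τ.map_suppProj_eq_iSup (mul_mem (star_mem (star_mem hx)) (star_mem hx))
      (star_mul_self_nonneg _) h2]
  refine iSup_congr fun k => ?_
  -- Here `1 - (1 - x* x)^k = b x* x` with `b = ∑_{j<k} (1 - x* x)^j ≥ 0` commuting with `x* x`; by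
  -- intertwining, `x b x*` is `1 - (1 - x x*)^k`.
  rw [one_sub_one_sub_pow_eq (star x * x), ← τ.map_conj_eq hx (sum_mem fun j _ => hmem j)
    (Finset.sum_nonneg fun j _ => one_sub_pow_nonneg h1 j), one_sub_one_sub_pow_eq, star_star,
    Finset.mul_sum, Finset.sum_mul, Finset.sum_mul]
  · simp only [mul_one_sub_pow_mul]
  · exact Commute.sum_left _ _ _ fun j _ =>
      ((Commute.one_left _).sub_left (Commute.refl _)).pow_left j

/-- `K` is the projection onto the vectors of `Ran n` killed by `m`. -/
theorem map_eq_add_map_suppProj {n m K : H →L[ℂ] H} (hn : IsStarProjection n) (hnN : n ∈ N)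
    (hmN : m ∈ N) (hK : IsStarProjection K)
    (h : ∀ x, K x = x ↔ n x = x ∧ m x = 0) : τ n = τ K + τ (suppProj (m * n)) := by
  have hkn : kerProj (m * n) * (1 - n) = 1 - n := kerProj_mul_eq_self (by
    rw [mul_assoc, mul_sub, mul_one, hn.isIdempotentElem.eq, sub_self, mul_zero])
  have hle : 1 - n ≤ kerProj (m * n) :=
    (hn.one_sub.le_iff_mul_eq_right (isStarProjection_kerProj _)).2 hkn
  have hp := (hn.one_sub.le_iff_sub (isStarProjection_kerProj _)).1 hle
  have hKn : kerProj (m * n) * n = kerProj (m * n) - (1 - n) := by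
    rw [mul_sub, mul_one] at hkn
    rw [← hkn]; abel
  have hnK : n * (kerProj (m * n) - (1 - n)) = kerProj (m * n) - (1 - n) := by
    have := congrArg star hKn
    rw [star_mul, hn.isSelfAdjoint.star_eq, (isStarProjection_kerProj _).isSelfAdjoint.star_eq,
      hp.isSelfAdjoint.star_eq] at this
    rw [mul_sub, this, mul_sub, mul_one, hn.isIdempotentElem.eq, sub_self, sub_zero]
  -- The kernel of `m n` contains `Ran (1 - n)`; what remains of it inside `Ran n` is `K`.
  have hKeq : K = kerProj (m * n) - (1 - n) := by
    refine eq_of_apply_eq_self_iff hK hp fun x => ?_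
    rw [h]
    constructor
    · rintro ⟨h1, h2⟩
      rw [← hKn]
      change kerProj (m * n) (n x) = x
      rw [h1, kerProj_apply_eq_self_iff]
      change m (n x) = 0
      rw [h1, h2]
    · intro hx
      have h1 : n x = x := by
        have := DFunLike.congr_fun hnK x
        change n ((kerProj (m * n) - (1 - n)) x) = (kerProj (m * n) - (1 - n)) x at this
        rwa [hx] at this
      rw [← hKn] at hx
      change kerProj (m * n) (n x) = x at hx
      rw [h1, kerProj_apply_eq_self_iff] at hx
      change m (n x) = 0 at hx
      rw [h1] at hx
      exact ⟨h1, hx⟩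
  have hmn := mul_mem hmN hnN
  have hKN : K ∈ N := by
    rw [hKeq]; exact sub_mem (kerProj_mem hmn) (sub_mem (one_mem N) hnN)
  rw [← τ.map_add K hKN _ (suppProj_mem hmn) hK.nonneg (isStarProjection_suppProj _).nonneg]
  congr 1
  rw [hKeq, suppProj]
  abel

variable {τ}

theorem IsFiniteProj.of_le {p q : H →L[ℂ] H} (hp : τ.IsFiniteProj p) (hq : IsStarProjection q)
    (hqN : q ∈ N) (h : q ≤ p) : τ.IsFiniteProj q :=
  ⟨hqN, hq, (τ.map_mono hqN hp.mem hq.nonneg h).trans_lt hp.finite⟩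

theorem IsFiniteProj.mem_compactIdeal {p : H →L[ℂ] H} (hp : τ.IsFiniteProj p) :
    p ∈ τ.compactIdeal :=
  Submodule.le_topologicalClosure _ <| Submodule.subset_span
    ⟨1, one_mem N, 1, one_mem N, p, hp, by simp⟩

/-- On `Ran (1 - m)` the product acts as `1 - n`, so the kernel term of the index is the projection
`n ∩ (1 - m)`. -/
theorem meetProj_kerProj_apply_eq_self_iff {n m x : H →L[ℂ] H} {v : H}
    (hm : IsStarProjection m)
    (hx : x = (1 - n) * (1 - m)) :
    meetProj (kerProj x) (1 - m) v = v ↔ n v = v ∧ m v = 0 := by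
  rw [meetProj_apply_eq_self_iff (isStarProjection_kerProj _) hm.one_sub,
    kerProj_apply_eq_self_iff, hx]
  change (1 - n) ((1 - m) v) = 0 ∧ v - m v = v ↔ _
  rw [sub_eq_self]
  constructor
  · rintro ⟨h1, h2⟩
    change (v - m v) - n (v - m v) = 0 at h1
    rw [h2, sub_zero, sub_eq_zero] at h1
    exact ⟨h1.symm, h2⟩
  · rintro ⟨h1, h2⟩
    refine ⟨?_, h2⟩
    change (v - m v) - n (v - m v) = 0
    rw [h2, sub_zero, h1, sub_self]

variable (τ) in
/-- **Kaplansky's formula** for the essential codimension of two `τ`-cofinite projections. -/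
theorem essCodim_one_sub {n m : H →L[ℂ] H} (hn : τ.IsFiniteProj n) (hm : τ.IsFiniteProj m) :
    τ.essCodim (1 - n) (1 - m) = (τ n).toReal - (τ m).toReal := by
  have hns := hn.isStarProjection
  have hms := hm.isStarProjection
  have hstar : star ((1 - n) * (1 - m)) = (1 - m) * (1 - n) := by
    rw [star_mul, hns.one_sub.isSelfAdjoint.star_eq, hms.one_sub.isSelfAdjoint.star_eq]
  have h1 := τ.map_eq_add_map_suppProj hns hn.mem hm.mem
    (isStarProjection_meetProj (kerProj ((1 - n) * (1 - m))) (1 - m))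
    fun x => meetProj_kerProj_apply_eq_self_iff hms rfl
  have h2 := τ.map_eq_add_map_suppProj hms hm.mem hn.mem
    (isStarProjection_meetProj (kerProj ((1 - m) * (1 - n))) (1 - n))
    fun x => meetProj_kerProj_apply_eq_self_iff hns rfl
  have h3 : τ (suppProj (n * m)) = τ (suppProj (m * n)) := by
    have := τ.map_suppProj_star (mul_mem hm.mem hn.mem)
      ((norm_mul_le _ _).trans (mul_le_one₀ hms.norm_le (norm_nonneg _) hns.norm_le))
    rwa [star_mul, hns.isSelfAdjoint.star_eq, hms.isSelfAdjoint.star_eq] at this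
  have f1 := hn.finite
  have f2 := hm.finite
  rw [h1, ENNReal.add_lt_top] at f1
  rw [h2, ENNReal.add_lt_top] at f2
  rw [essCodim, skewIndex, hstar, h1, h2, h3, ENNReal.toReal_add f1.1.ne f1.2.ne,
    ENNReal.toReal_add f2.1.ne (h3 ▸ f1.2.ne)]
  ring

/-- The product of two projections `1 - n`, `1 - m` with `n, m` below a `τ`-finite projection
is skew-Fredholm. -/
theorem isSkewFredholm_one_sub {P n m : H →L[ℂ] H} (hP : τ.IsFiniteProj P)
    (hn : IsStarProjection n) (hnN : n ∈ N) (hnP : n ≤ P)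
    (hm : IsStarProjection m) (hmN : m ∈ N) (hmP : m ≤ P) :
    τ.IsSkewFredholm (1 - n) (1 - m) ((1 - n) * (1 - m)) := by
  have hstar : star ((1 - n) * (1 - m)) = (1 - m) * (1 - n) := by
    rw [star_mul, hn.one_sub.isSelfAdjoint.star_eq, hm.one_sub.isSelfAdjoint.star_eq]
  have hnN' := sub_mem (one_mem N) hnN
  have hmN' := sub_mem (one_mem N) hmN
  have hPs := hP.isStarProjection
  -- The kernel term lies below `n`. The adjoint exchanges `n` and `m`, so one statement handles
  -- kernel and cokernel.
  have key : ∀ {n m : H →L[ℂ] H}, IsStarProjection n → n ∈ N → n ≤ P → IsStarProjection m →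
      m ∈ N → τ.IsFiniteProj (meetProj (kerProj ((1 - n) * (1 - m))) (1 - m)) := by
    intro n m hn hnN hnP hm hmN
    have hnN' := sub_mem (one_mem N) hnN
    have hmN' := sub_mem (one_mem N) hmN
    refine (hP.of_le hn hnN hnP).of_le (isStarProjection_meetProj _ _)
      (meetProj_mem (kerProj_mem (mul_mem hnN' hmN')) hmN' (isStarProjection_kerProj _)
        hm.one_sub) (le_of_apply_eq_self (isStarProjection_meetProj _ _) hn fun x hx => ?_)
    exact ((meetProj_kerProj_apply_eq_self_iff hm rfl).1 hx).1
  refine ⟨mul_mem hnN' hmN', key hn hnN hnP hm hmN, ?_, 1 - P, sub_mem (one_mem N) hP.mem,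
    hPs.one_sub, ?_, ?_⟩
  · rw [hstar]
    exact key hm hmN hmP hn hnN
  · rw [sub_sub_sub_cancel_left]
    exact hP.of_le ((hn.le_iff_sub hPs).1 hnP) (sub_mem hP.mem hnN) (sub_le_self P hn.nonneg)
  -- The witness `1 - P` works because `n` and `m` kill its range, on which the product is therefore
  -- the identity.
  · have h1 : n * (1 - P) = 0 := by
      rw [mul_sub, mul_one, (hn.le_iff_mul_eq_left hPs).1 hnP, sub_self]
    have h2 : m * (1 - P) = 0 := by
      rw [mul_sub, mul_one, (hm.le_iff_mul_eq_left hPs).1 hmP, sub_self]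
    have h3 : (1 - n) * (1 - m) * (1 - P) = 1 - P := by
      rw [mul_assoc, sub_mul 1 m, one_mul, h2, sub_zero, sub_mul 1 n, one_mul, h1, sub_zero]
    rintro _ ⟨x, rfl⟩
    exact ⟨(1 - P) x, DFunLike.congr_fun h3 x⟩

end NormalTrace

/-! ### Spectral projections of self-adjoint operators -/

theorem specPos_mul_specNeg (T : H →L[ℂ] H) : specPos T * specNeg T = 0 :=
  suppProj_mul_suppProj_eq_zero (CFC.negPart_nonneg T).isSelfAdjoint
    (CFC.posPart_mul_negPart T)

theorem specNeg_mul_specPos (T : H →L[ℂ] H) : specNeg T * specPos T = 0 :=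
  suppProj_mul_suppProj_eq_zero (CFC.posPart_nonneg T).isSelfAdjoint
    (CFC.negPart_mul_posPart T)

/-- `T⁺` and `T⁻` have orthogonal supports, and `T` vanishes off their sum. Conversely, multiplying
`T k = 0` by `T⁺` leaves `(T⁺)² k = 0`, whence `T⁺ k = 0`; likewise for `T⁻`. -/
theorem suppProj_eq_specPos_add_specNeg {T : H →L[ℂ] H} (hT : IsSelfAdjoint T) :
    suppProj T = specPos T + specNeg T := by
  have hp := isStarProjection_suppProj T⁺
  have hn := isStarProjection_suppProj T⁻
  have hadd : IsStarProjection (specPos T + specNeg T) := by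
    refine ⟨?_, hp.isSelfAdjoint.add hn.isSelfAdjoint⟩
    rw [IsIdempotentElem, add_mul, mul_add, mul_add, specPos_mul_specNeg, specNeg_mul_specPos,
      add_zero, zero_add]
    exact congrArg₂ _ hp.isIdempotentElem.eq hn.isIdempotentElem.eq
  have h1 : T⁺ * (1 - (specPos T + specNeg T)) = 0 := by
    have h : T⁺ * specNeg T = 0 := by
      have := congrArg star (suppProj_mul_eq_zero (CFC.negPart_mul_posPart T))
      rwa [star_mul, (CFC.posPart_nonneg T).isSelfAdjoint.star_eq, hn.isSelfAdjoint.star_eq,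
        star_zero] at this
    rw [mul_sub, mul_add, mul_one, h, specPos, mul_suppProj, add_zero, sub_self]
  have h2 : T⁻ * (1 - (specPos T + specNeg T)) = 0 := by
    have h : T⁻ * specPos T = 0 := by
      have := congrArg star (suppProj_mul_eq_zero (CFC.posPart_mul_negPart T))
      rwa [star_mul, (CFC.negPart_nonneg T).isSelfAdjoint.star_eq, hp.isSelfAdjoint.star_eq,
        star_zero] at this
    rw [mul_sub, mul_add, mul_one, h, specNeg, mul_suppProj, zero_add, sub_self]
  refine le_antisymm (suppProj_le hadd ?_) ?_
  · have h3 : ∀ q, T * q = T⁺ * q - T⁻ * q := fun q => by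
      rw [← sub_mul, CFC.posPart_sub_negPart T hT]
    rw [h3, h1, h2, sub_zero]
  · have h3 : T * kerProj T = 0 := mul_kerProj T
    have h4 : T⁺ * (T⁺ * kerProj T) = 0 := by
      have := congrArg (T⁺ * ·) h3
      nth_rw 2 [← CFC.posPart_sub_negPart T hT] at this
      simpa [sub_mul, mul_sub, ← mul_assoc] using this
    have h5 : T⁻ * (T⁻ * kerProj T) = 0 := by
      have := congrArg (T⁻ * ·) h3
      nth_rw 2 [← CFC.posPart_sub_negPart T hT] at this
      simpa [sub_mul, mul_sub, ← mul_assoc] using this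
    have hsq : ∀ {a k : H →L[ℂ] H}, IsSelfAdjoint a → a * (a * k) = 0 → a * k = 0 := by
      intro a k ha h
      rw [← CStarRing.star_mul_self_eq_zero_iff, star_mul, ha.star_eq, mul_assoc, h, mul_zero]
    have h6 := suppProj_mul_eq_zero (hsq (CFC.posPart_nonneg T).isSelfAdjoint h4)
    have h7 := suppProj_mul_eq_zero (hsq (CFC.negPart_nonneg T).isSelfAdjoint h5)
    rw [hadd.le_iff_mul_eq_left (isStarProjection_suppProj T), suppProj, mul_sub, mul_one,
      add_mul, specPos, specNeg, h6, h7, add_zero, sub_zero]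

theorem specNeg_le_suppProj {T : H →L[ℂ] H} (hT : IsSelfAdjoint T) :
    specNeg T ≤ suppProj T := by
  rw [suppProj_eq_specPos_add_specNeg hT]
  exact le_add_of_nonneg_left (isStarProjection_suppProj _).nonneg

theorem specPos_le_suppProj {T : H →L[ℂ] H} (hT : IsSelfAdjoint T) :
    specPos T ≤ suppProj T := by
  rw [suppProj_eq_specPos_add_specNeg hT]
  exact le_add_of_nonneg_right (isStarProjection_suppProj _).nonneg

/-- A difference of orthogonal positive operators is its own Jordan decomposition. This evaluates
the trace of `sgn T`, which is defined through the two parts. -/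
theorem sgn_posPart_negPart (T : H →L[ℂ] H) : (sgn T)⁺ = specPos T ∧ (sgn T)⁻ = specNeg T :=
  CFC.posPart_negPart_unique rfl (specPos_mul_specNeg T) (isStarProjection_suppProj _).nonneg
    (isStarProjection_suppProj _).nonneg

theorem NormalTrace.sig_eq (τ : NormalTrace N) (T : H →L[ℂ] H) :
    τ.sig T = (τ (specPos T)).toReal - (τ (specNeg T)).toReal := by
  rw [NormalTrace.sig, NormalTrace.onSelfAdjoint, (sgn_posPart_negPart T).1,
    (sgn_posPart_negPart T).2]

theorem mul_eq_self_of_suppProj_le {T P : H →L[ℂ] H} (hP : IsStarProjection P)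
    (h : suppProj T ≤ P) : T * P = T := by
  rw [← mul_suppProj T, mul_assoc,
    ((isStarProjection_suppProj T).le_iff_mul_eq_left hP).1 h]

/-- `χ(T + 1 - P < 0) = χ(T < 0)` for self-adjoint `T` supported below `P`. -/
theorem specNeg_add_one_sub {T P : H →L[ℂ] H} (hT : IsSelfAdjoint T) (hP : IsStarProjection P)
    (h : suppProj T ≤ P) : specNeg (T + 1 - P) = specNeg T := by
  have h0 : (1 - P) * specNeg T = 0 := by
    rw [sub_mul, one_mul, ((isStarProjection_suppProj _).le_iff_mul_eq_right hP).1
      ((specNeg_le_suppProj hT).trans h), sub_self]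
  have h1 : (1 - P) * T⁻ = 0 := by
    have h2 : specNeg T * T⁻ = T⁻ := by
      have := congrArg star (mul_suppProj T⁻)
      rwa [star_mul, (CFC.negPart_nonneg T).isSelfAdjoint.star_eq,
        (isStarProjection_suppProj _).isSelfAdjoint.star_eq] at this
    rw [← h2, ← mul_assoc, h0, zero_mul]
  -- `T⁺ + (1 - P)` and `T⁻` are positive with product zero and difference `T + 1 - P`.
  have h3 := CFC.posPart_negPart_unique (a := T + 1 - P) (b := T⁺ + (1 - P)) (c := T⁻)
    (by nth_rw 1 [← CFC.posPart_sub_negPart T hT]; abel)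
    (by rw [add_mul, h1, CFC.posPart_mul_negPart, add_zero])
    (add_nonneg (CFC.posPart_nonneg T) hP.one_sub.nonneg) (CFC.negPart_nonneg T)
  rw [specNeg, specNeg, h3.2]

/-! ### The spectral flow -/

variable {τ : NormalTrace N}

theorem mul_kerProj_eq_sub_suppProj {T P : H →L[ℂ] H} (hP : IsStarProjection P)
    (h : suppProj T ≤ P) : P * kerProj T = P - suppProj T := by
  rw [← sub_sub_cancel 1 (kerProj T), ← suppProj, mul_sub, mul_one,
    ((isStarProjection_suppProj T).le_iff_mul_eq_right hP).1 h]

theorem mul_eq_self_of_isSelfAdjoint_of_suppProj_le {T P : H →L[ℂ] H} (hT : IsSelfAdjoint T)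
    (hP : IsStarProjection P) (h : suppProj T ≤ P) : P * T = T := by
  have := congrArg star (mul_eq_self_of_suppProj_le hP h)
  rwa [star_mul, hT.star_eq, hP.isSelfAdjoint.star_eq] at this

namespace NormalTrace

/-- The operator is the identity on the corner of `1 - P`: multiplying by `1 - P` on the left
confines the kernel to `P`, and on the right it puts `Ran (1 - P)` inside the range. -/
theorem add_one_sub_mem_saFredholm {T P : H →L[ℂ] H} (hP : τ.IsFiniteProj P) (hTN : T ∈ N)
    (hT : IsSelfAdjoint T) (h : suppProj T ≤ P) : T + 1 - P ∈ τ.saFredholm := by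
  have hPs := hP.isStarProjection
  have hsa : IsSelfAdjoint (T + 1 - P) := (hT.add (IsSelfAdjoint.one _)).sub hPs.isSelfAdjoint
  have hmem : T + 1 - P ∈ N := sub_mem (add_mem hTN (one_mem N)) hP.mem
  have hPT := mul_eq_self_of_isSelfAdjoint_of_suppProj_le hT hPs h
  have hTP := mul_eq_self_of_suppProj_le hPs h
  have hl : (1 - P) * (T + 1 - P) = 1 - P := by
    rw [mul_sub, mul_add, sub_mul, hPT, one_mul, sub_self, zero_add, mul_one, sub_mul, one_mul,
      hPs.isIdempotentElem.eq, sub_self, sub_zero]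
  have hr : (T + 1 - P) * (1 - P) = 1 - P := by
    rw [sub_mul, add_mul, mul_sub, hTP, mul_one, sub_self, zero_add, one_mul, mul_sub, mul_one,
      hPs.isIdempotentElem.eq, sub_self, sub_zero]
  have hker : τ.IsFiniteProj (meetProj (kerProj (T + 1 - P)) 1) := by
    refine hP.of_le (isStarProjection_meetProj _ _)
      (meetProj_mem (kerProj_mem hmem) (one_mem N) (isStarProjection_kerProj _) (.one _))
      (le_of_apply_eq_self (isStarProjection_meetProj _ _) hPs fun x hx => ?_)
    have h0 := kerProj_apply_eq_self_iff.1
      ((meetProj_apply_eq_self_iff (isStarProjection_kerProj _) (.one _)).1 hx).1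
    have h1 : (1 - P) ((T + 1 - P) x) = x - P x := DFunLike.congr_fun hl x
    rw [h0, map_zero] at h1
    exact (sub_eq_zero.1 h1.symm).symm
  refine ⟨hsa, hmem, hker, by rwa [hsa.star_eq], 1 - P, sub_mem (one_mem N) hP.mem,
    hPs.one_sub, by rwa [sub_sub_cancel], ?_⟩
  rintro _ ⟨x, rfl⟩
  exact ⟨(1 - P) x, DFunLike.congr_fun hr x⟩

theorem IsFiniteProj.toReal_map_sub {p q : H →L[ℂ] H} (hp : τ.IsFiniteProj p)
    (hq : IsStarProjection q) (hqN : q ∈ N) (h : q ≤ p) :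
    (τ (p - q)).toReal = (τ p).toReal - (τ q).toReal := by
  have hadd := τ.map_add q hqN (p - q) (sub_mem hp.mem hqN) hq.nonneg (sub_nonneg.2 h)
  rw [add_sub_cancel] at hadd
  have hf := hp.finite
  rw [hadd, ENNReal.add_lt_top] at hf
  rw [hadd, ENNReal.toReal_add hf.1.ne hf.2.ne, add_sub_cancel_left]

/-- Half of the signature plus half of the nullity inside `P` is `τ(P) / 2 - τ(χ(T < 0))`. -/
theorem sig_add_toReal_map_mul_kerProj {T P : H →L[ℂ] H} (hP : τ.IsFiniteProj P) (hTN : T ∈ N)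
    (hT : IsSelfAdjoint T) (h : suppProj T ≤ P) :
    τ.sig T + (τ (P * kerProj T)).toReal = (τ P).toReal - 2 * (τ (specNeg T)).toReal := by
  have hpos := isStarProjection_suppProj T⁺
  have hneg := isStarProjection_suppProj T⁻
  have hposN := suppProj_mem (posPart_mem hTN)
  have hnegN := suppProj_mem (negPart_mem hTN)
  have hp := hP.of_le hpos hposN ((specPos_le_suppProj hT).trans h)
  have hn := hP.of_le hneg hnegN ((specNeg_le_suppProj hT).trans h)
  rw [mul_kerProj_eq_sub_suppProj hP.isStarProjection h,
    hP.toReal_map_sub (isStarProjection_suppProj T) (suppProj_mem hTN) h, sig_eq,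
    suppProj_eq_specPos_add_specNeg hT, specPos, specNeg,
    τ.map_add _ hposN _ hnegN hpos.nonneg hneg.nonneg,
    ENNReal.toReal_add hp.finite.ne hn.finite.ne]
  ring

/-- If all the `χ(F_t ≥ 0)` have complements below one `τ`-finite projection, then the spectral
flow is the difference of the traces of the negative spectral projections at the end points. -/
theorem hasSpectralFlow_of_specNeg_le {P : H →L[ℂ] H} (hP : τ.IsFiniteProj P)
    {F : unitInterval → H →L[ℂ] H} (hFN : ∀ t, F t ∈ N) (hF : ∀ t, specNeg (F t) ≤ P) :
    τ.HasSpectralFlow F ((τ (specNeg (F 0))).toReal - (τ (specNeg (F 1))).toReal) := by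
  have hs : ∀ t, IsStarProjection (specNeg (F t)) := fun t => isStarProjection_suppProj _
  have hN : ∀ t, specNeg (F t) ∈ N := fun t => suppProj_mem (negPart_mem (hFN t))
  have hfin : ∀ t, τ.IsFiniteProj (specNeg (F t)) := fun t => hP.of_le (hs t) (hN t) (hF t)
  refine ⟨⟨0, ![0, 1], ?_, rfl, rfl, fun k r _ s _ => ?_⟩, fun n t ht => ⟨fun k => ?_, ?_⟩⟩
  · rw [Fin.strictMono_iff_lt_succ]
    intro i
    fin_cases i
    exact zero_lt_one
  -- Two complements of `τ`-finite projections differ by a compact element, so even the trivial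
  -- partition `{0, 1}` is fine, with Calkin norm `0`.
  · have : specNonneg (F s) - specNonneg (F r) ∈ τ.compactIdeal := by
      rw [specNonneg, specNonneg, sub_sub_sub_cancel_left]
      exact sub_mem (hfin r).mem_compactIdeal (hfin s).mem_compactIdeal
    rw [calkinNorm, Metric.infDist_zero_of_mem this]
    norm_num
  · exact isSkewFredholm_one_sub hP (hs _) (hN _) (hF _) (hs _) (hN _) (hF _)
  · have htel : ∀ (n : ℕ) (f : Fin (n + 1) → ℝ),
        ∑ k : Fin n, (f k.castSucc - f k.succ) = f 0 - f (Fin.last n) := by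
      intro n
      induction n with
      | zero => intro f; simp
      | succ n ih =>
        intro f
        rw [Fin.sum_univ_castSucc]
        have := ih fun k => f k.castSucc
        simp only [Fin.succ_castSucc, Fin.succ_last, Fin.castSucc_zero] at this ⊢
        rw [this]
        ring
    simp only [specNonneg, essCodim_one_sub τ (hfin _) (hfin _)]
    rw [htel (n + 1) fun k => (τ (specNeg (F (t k)))).toReal, ht.first, ht.last]

end NormalTrace

/-- The inverse `S` gives `P = S T`, and `T` kills its kernel projection. -/
theorem IsInvertibleInCorner.mul_kerProj_eq_zero {P T : H →L[ℂ] H}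
    (h : IsInvertibleInCorner N P T) : P * kerProj T = 0 := by
  obtain ⟨-, S, -, -, -, hS⟩ := h
  rw [← hS, mul_assoc, mul_kerProj, mul_zero]

end SemifiniteFlow

theorem mainTheorem2 {H : Type*} [NormedAddCommGroup H] [InnerProductSpace ℂ H]
    [CompleteSpace H] (N : VonNeumannAlgebra H) (τ : SemifiniteFlow.NormalTrace N)
    (P : H →L[ℂ] H) (hP : τ.IsFiniteProj P)
    (T : unitInterval → H →L[ℂ] H) (hTcont : Continuous T)
    (hTN : ∀ t, T t ∈ N) (hTsa : ∀ t, IsSelfAdjoint (T t))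
    (hsupp : ∀ t, SemifiniteFlow.suppProj (T t) ≤ P)
    (hrange : ∀ t, SemifiniteFlow.rangeProj (T t) ≤ P)
    (F : unitInterval → H →L[ℂ] H) (hF : ∀ t, F t = P * T t * P + 1 - P) :
    -- `F` is a norm-continuous path of self-adjoint Breuer-Fredholm operators
    (Continuous F ∧ ∀ t, F t ∈ τ.saFredholm) ∧
    -- the signatures and the kernel terms are defined
    (∀ t, τ.IsFiniteProj (SemifiniteFlow.suppProj (T t)) ∧
      τ.IsFiniteProj (P * SemifiniteFlow.kerProj (T t))) ∧
    -- the formula for the spectral flow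
    τ.HasSpectralFlow F
      (1 / 2 * (τ.sig (T 1) - τ.sig (T 0)) +
        1 / 2 * ((τ (P * SemifiniteFlow.kerProj (T 1))).toReal -
          (τ (P * SemifiniteFlow.kerProj (T 0))).toReal)) ∧
    -- the case of invertible endpoints
    (SemifiniteFlow.IsInvertibleInCorner N P (T 0) →
      SemifiniteFlow.IsInvertibleInCorner N P (T 1) →
      1 / 2 * ((τ (P * SemifiniteFlow.kerProj (T 1))).toReal -
          (τ (P * SemifiniteFlow.kerProj (T 0))).toReal) = 0 ∧
      τ.HasSpectralFlow F (1 / 2 * (τ.sig (T 1) - τ.sig (T 0)))) := by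
  have hPs := hP.isStarProjection
  have hF' : ∀ t, F t = T t + 1 - P := fun t => by
    rw [hF, mul_assoc, SemifiniteFlow.mul_eq_self_of_suppProj_le hPs (hsupp t),
      SemifiniteFlow.mul_eq_self_of_isSelfAdjoint_of_suppProj_le (hTsa t) hPs (hsupp t)]
  have hneg : ∀ t, SemifiniteFlow.specNeg (F t) = SemifiniteFlow.specNeg (T t) := fun t => by
    rw [hF', SemifiniteFlow.specNeg_add_one_sub (hTsa t) hPs (hsupp t)]
  have hflow : τ.HasSpectralFlow F
      (1 / 2 * (τ.sig (T 1) - τ.sig (T 0)) +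
        1 / 2 * ((τ (P * SemifiniteFlow.kerProj (T 1))).toReal -
          (τ (P * SemifiniteFlow.kerProj (T 0))).toReal)) := by
    have h := SemifiniteFlow.NormalTrace.hasSpectralFlow_of_specNeg_le (F := F) hP
      (fun t => hF' t ▸ sub_mem (add_mem (hTN t) (one_mem N)) hP.mem)
      (fun t => hneg t ▸ (SemifiniteFlow.specNeg_le_suppProj (hTsa t)).trans (hsupp t))
    rw [hneg, hneg] at h
    convert h using 1
    -- Subtracting the identities at the two end points cancels `τ(P)`, and halving gives `τ(n_0) -
    -- τ(n_1)`.
    have h0 := SemifiniteFlow.NormalTrace.sig_add_toReal_map_mul_kerProj hP (hTN 0) (hTsa 0)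
      (hsupp 0)
    have h1 := SemifiniteFlow.NormalTrace.sig_add_toReal_map_mul_kerProj hP (hTN 1) (hTsa 1)
      (hsupp 1)
    linarith
  refine ⟨⟨?_, fun t => ?_⟩, fun t => ⟨?_, ?_⟩, hflow, fun h0 h1 => ?_⟩
  · rw [funext hF']
    exact (hTcont.add continuous_const).sub continuous_const
  · rw [hF']
    exact SemifiniteFlow.NormalTrace.add_one_sub_mem_saFredholm hP (hTN t) (hTsa t) (hsupp t)
  · exact hP.of_le (SemifiniteFlow.isStarProjection_suppProj _)
      (SemifiniteFlow.suppProj_mem (hTN t)) (hsupp t)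
  · have hs := SemifiniteFlow.isStarProjection_suppProj (T t)
    rw [SemifiniteFlow.mul_kerProj_eq_sub_suppProj hPs (hsupp t)]
    exact hP.of_le ((hs.le_iff_sub hPs).1 (hsupp t))
      (sub_mem hP.mem (SemifiniteFlow.suppProj_mem (hTN t))) (sub_le_self P hs.nonneg)
  · have hz : 1 / 2 * ((τ (P * SemifiniteFlow.kerProj (T 1))).toReal -
        (τ (P * SemifiniteFlow.kerProj (T 0))).toReal) = 0 := by
      rw [h0.mul_kerProj_eq_zero, h1.mul_kerProj_eq_zero, sub_self, mul_zero]
    rw [hz, add_zero] at hflow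
    exact ⟨hz, hflow⟩
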